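/- Let $E$ and $F$ be nonzero (real) Banach lattices, let $B_E$, $B_F$ be their closed unit balls, and let $E'$, $F'$ be their norm duals, $E'$ carrying its usual order ($\varphi\le\psi$ if and only if $\varphi(x)\le\psi(x)$ for all $x\ge 0$ in $E$). A continuous linear operator $T:E\to F$ is called *positive* if $Tx\ge 0$ for every $x\ge 0$; *semi-compact* if for each $\varepsilon>0$ there is $u\in F$, $u\ge 0$, with $T(B_E)\subset[-u,u]+\varepsilon B_F$; and *almost M-weakly compact* if $f_n(T x_n)\to 0$ for every disjoint sequence $(x_n)$ in $B_E$ (that is, $|x_n|\wedge|x_m|=0$ for $n\ne m$) and every weakly convergent sequence $(f_n)$ in $F'$. The norm of $E'$ is *order continuous* if $\|\varphi_\alpha\|\to 0$ for every net $(\varphi_\alpha)$ in $E'$ with $\varphi_\alpha\downarrow 0$, i.e. for every decreasing net with infimum $0$. Then the following are equivalent: 1. every positive semi-compact operator $T:E\to F$ is almost M-weakly compact; 2. the norm of $E'$ is order continuous. -/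

import Mathlib

open Set Filter Topology
open scoped Pointwise

/-- The canonical order of the dual of an ordered normed space:
`f ≤ g` if and only if `f x ≤ g x` for every `x ≥ 0`. When `E` is a Banach lattice this is the order
of the dual Banach lattice `E'`. (Antisymmetry uses `x = x⁺ - x⁻`.) -/
instance StrongDual.instPartialOrderOfLattice {E : Type*} [NormedAddCommGroup E] [NormedSpace ℝ E]
    [Lattice E] [IsOrderedAddMonoid E] : PartialOrder (StrongDual ℝ E) where
  le f g := ∀ x : E, 0 ≤ x → f x ≤ g x
  le_refl _ _ _ := le_rfl
  le_trans _ _ _ hfg hgh x hx := (hfg x hx).trans (hgh x hx)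
  le_antisymm f g hfg hgf := by
    ext x
    have key : ∀ y : E, 0 ≤ y → f y = g y := fun y hy => le_antisymm (hfg y hy) (hgf y hy)
    rw [← posPart_sub_negPart x, map_sub, map_sub, key _ (posPart_nonneg x),
      key _ (negPart_nonneg x)]

/-- The norm is order continuous: `x_α ↓ 0` implies `‖x_α‖ → 0` for every net `x_α`, where `x_α ↓ 0`
means that the net is decreasing with infimum `0`. (Index sets in the universe of `V` suffice, since
a decreasing net may be replaced by its range, a downward directed subset of `V`.) -/
def IsOrderContinuousNorm.{u} (V : Type u) [NormedAddCommGroup V] [PartialOrder V] : Prop :=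
  ∀ (ι : Type u) [Preorder ι] [IsDirectedOrder ι] [Nonempty ι] (x : ι → V),
    Antitone x → IsGLB (range x) 0 → Tendsto (fun i => ‖x i‖) atTop (𝓝 0)

/-- A sequence in a vector lattice is disjoint if its terms are pairwise disjoint. -/
def IsDisjointSeq {E : Type*} [AddCommGroup E] [Lattice E] (x : ℕ → E) : Prop :=
  ∀ m n : ℕ, m ≠ n → |x m| ⊓ |x n| = 0

/-- A sequence in a normed space is weakly convergent if it converges to some point
in the weak topology (for a dual space `Y'` this is the topology `σ(Y', Y'')`). -/
def IsWeaklyConvergentSeq {V : Type*} [NormedAddCommGroup V] [NormedSpace ℝ V]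
    (f : ℕ → V) : Prop :=
  ∃ g : V, Tendsto (fun n => toWeakSpace ℝ V (f n)) atTop (𝓝 (toWeakSpace ℝ V g))

namespace ContinuousLinearMap

/-- A bounded operator `T : X → F` into a Banach lattice is semi-compact if for each `ε > 0`
there is `u ∈ F₊` with `T(B_X) ⊆ [-u, u] + ε B_F`. -/
def IsSemiCompact {X F : Type*} [NormedAddCommGroup X] [NormedSpace ℝ X]
    [NormedAddCommGroup F] [NormedSpace ℝ F] [Lattice F] (T : X →L[ℝ] F) : Prop :=
  ∀ ε : ℝ, 0 < ε → ∃ u : F, 0 ≤ u ∧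
    T '' Metric.closedBall (0 : X) 1 ⊆ Icc (-u) u + ε • Metric.closedBall (0 : F) 1

/-- A bounded operator `T : E → Y` on a Banach lattice is almost M-weakly compact if
`f_n (T x_n) → 0` for every disjoint sequence `x_n` in `B_E` and every weakly convergent
sequence `f_n` in `Y'`. -/
def IsAlmostMWeaklyCompact {E Y : Type*} [NormedAddCommGroup E] [NormedSpace ℝ E] [Lattice E]
    [NormedAddCommGroup Y] [NormedSpace ℝ Y] (T : E →L[ℝ] Y) : Prop :=
  ∀ (x : ℕ → E) (f : ℕ → StrongDual ℝ Y),
    (∀ n, x n ∈ Metric.closedBall (0 : E) 1) → IsDisjointSeq x → IsWeaklyConvergentSeq f →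
      Tendsto (fun n => f n (T (x n))) atTop (𝓝 0)

end ContinuousLinearMap

/-!
The link between the two conditions is a third one: every positive functional `φ` on `E` tends to
`0` along every disjoint sequence of the unit ball.

*Order continuity gives the third condition* (`IsOrderContinuousNorm.tendsto_apply_of_disjoint`).
For a disjoint sequence `e n ≥ 0` the components of `φ` on the bands generated by the `e n`
(`exists_component`) have partial sums below `φ`. These partial sums increase, hence converge in
norm, so the components tend to `0` in norm; the `n`-th one agrees with `φ` at `e n`.

*The third condition gives order continuity* (`isOrderContinuousNorm_of_tendsto_apply`). If a net
decreases to `0` with norms bounded below, almost norming vectors are picked recursively and made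
disjoint (`isDisjointSeq_posPart_sub`), on which an initial member of the net stays away from `0`.

*The first condition gives the third*, by testing on the operators `φ ⊗ y` with `0 ≤ y ∈ F`, which
are semi-compact, and on constant sequences of functionals.

*The third condition gives the first*
(`ContinuousLinearMap.IsSemiCompact.isAlmostMWeaklyCompact`). Subtracting the weak limit, let
`f n → 0` weakly in `F'`. Semi-compactness allows `T (x n)` to be truncated to an order interval
`[-u, u]`, up to a small error in norm. Writing `w n` for the truncated positive or negative parts,
`0 ≤ w n ≤ u` and positive functionals tend to `0` along `w`, because `|T (x n)| ≤ T |x n|`. The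
crux is `tendsto_apply_of_weaklyNull`: then `f n (w n) → 0`. If not, a sequence in `[0, u]` is built
whose successive differences are dominated by a sparse subsequence of `w` and on which the
corresponding `f n` stay away from `0` from some index on. A weak-star cluster point of it in the
bidual contradicts `f n → 0` weakly. Staying inside `[0, u]` keeps the sequence bounded, and is
possible since `w ≤ w ⊓ s + w ⊓ (u - s)` for `s, w ∈ [0, u]`: up to the Riesz decomposition, `w` is
a sum of a piece that can be subtracted from `s` and a piece that can be added to it.
-/

/-! ### Disjointness and decomposition in lattice ordered groups -/

section LatticeOrderedGroup

variable {G : Type*} [AddCommGroup G] [Lattice G] [IsOrderedAddMonoid G]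

theorem add_inf_le_inf_add_inf {a b c : G} (ha : 0 ≤ a) (hb : 0 ≤ b) (hc : 0 ≤ c) :
    (a + b) ⊓ c ≤ a ⊓ c + b ⊓ c := by
  rw [add_inf, inf_add, inf_add]
  refine le_inf (le_inf inf_le_left ?_) (le_inf ?_ ?_)
  · exact inf_le_right.trans (le_add_of_nonneg_right hb)
  · exact inf_le_right.trans (le_add_of_nonneg_left ha)
  · exact inf_le_right.trans (le_add_of_nonneg_right hc)

/-- The Riesz decomposition property. -/
theorem exists_add_eq_of_le_add {x y z : G} (hy : 0 ≤ y) (hz : 0 ≤ z) (hx : 0 ≤ x)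
    (h : z ≤ x + y) : ∃ a b, 0 ≤ a ∧ a ≤ x ∧ 0 ≤ b ∧ b ≤ y ∧ a + b = z := by
  refine ⟨z ⊓ x, z - z ⊓ x, le_inf hz hx, inf_le_right, sub_nonneg.2 inf_le_left, ?_, by abel⟩
  rw [sub_le_comm]
  exact le_inf (sub_le_self _ hy) (sub_le_iff_le_add.2 h)

theorem add_inf_eq_zero {a b c : G} (ha : 0 ≤ a) (hb : 0 ≤ b) (hc : 0 ≤ c) (hac : a ⊓ c = 0)
    (hbc : b ⊓ c = 0) : (a + b) ⊓ c = 0 := by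
  refine le_antisymm ?_ (le_inf (add_nonneg ha hb) hc)
  simpa [hac, hbc] using add_inf_le_inf_add_inf ha hb hc

theorem nsmul_inf_eq_zero {a c : G} (ha : 0 ≤ a) (hc : 0 ≤ c) (hac : a ⊓ c = 0) (k : ℕ) :
    (k • a) ⊓ c = 0 := by
  induction k with
  | zero => simpa using hc
  | succ k ih =>
    rw [succ_nsmul]
    exact add_inf_eq_zero (nsmul_nonneg ha k) ha hc ih hac

/-- A finite sum of pairwise disjoint positive elements is their supremum; in particular it stays
below every common upper bound. -/
theorem sum_le_of_disjoint {a : ℕ → G} {x : G} (hx : 0 ≤ x) (ha : ∀ n, 0 ≤ a n)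
    (hax : ∀ n, a n ≤ x) (hd : ∀ m n, m ≠ n → a m ⊓ a n = 0) (N : ℕ) :
    ∑ n ∈ Finset.range N, a n ≤ x := by
  have hdisj : ∀ N m, N ≤ m → (∑ n ∈ Finset.range N, a n) ⊓ a m = 0 := by
    intro N
    induction N with
    | zero => intro m _; simpa using ha m
    | succ N ih =>
      intro m hm
      rw [Finset.sum_range_succ]
      exact add_inf_eq_zero (Finset.sum_nonneg fun i _ => ha i) (ha N) (ha m) (ih m (by omega))
        (hd N m (by omega))
  induction N with
  | zero => simpa using hx
  | succ N ih =>
    rw [Finset.sum_range_succ, ← inf_add_sup, hdisj N N le_rfl, zero_add]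
    exact sup_le ih (hax N)

end LatticeOrderedGroup

/-! ### Functionals determined by their values on the positive cone -/

section SolidNorm

variable {E : Type*} [NormedAddCommGroup E] [Lattice E] [IsOrderedAddMonoid E] [HasSolidNorm E]

theorem norm_posPart_le (x : E) : ‖x⁺‖ ≤ ‖x‖ :=
  norm_le_norm_of_abs_le_abs (by
    rw [abs_of_nonneg (posPart_nonneg x)]; exact sup_le (le_abs_self x) (abs_nonneg x))

theorem norm_negPart_le (x : E) : ‖x⁻‖ ≤ ‖x‖ := by
  rw [← posPart_neg, ← norm_neg x]
  exact norm_posPart_le (-x)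

end SolidNorm

section Dual

variable {E : Type*} [NormedAddCommGroup E] [NormedSpace ℝ E] [Lattice E] [IsOrderedAddMonoid E]

/-- A bounded additive function on the positive cone of a normed lattice extends to a continuous
linear functional; real homogeneity comes for free from additivity and continuity. -/
theorem exists_strongDual_eqOn_cone [HasSolidNorm E] (p : E → ℝ) (C : ℝ)
    (hadd : ∀ x y, 0 ≤ x → 0 ≤ y → p (x + y) = p x + p y) (hb : ∀ x, 0 ≤ x → |p x| ≤ C * ‖x‖) :
    ∃ ψ : StrongDual ℝ E, ∀ x, 0 ≤ x → ψ x = p x := by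
  let q : E →+ ℝ := AddMonoidHom.mk' (fun x => p x⁺ - p x⁻) (by
    intro x y
    have h : (x + y)⁺ + (x⁻ + y⁻) = (x + y)⁻ + (x⁺ + y⁺) := by
      have h1 := posPart_sub_negPart (x + y)
      have h2 := posPart_sub_negPart x
      have h3 := posPart_sub_negPart y
      rw [sub_eq_iff_eq_add] at h1
      rw [h1]
      nth_rw 1 [← h2, ← h3]
      abel
    have h' := congrArg p h
    rw [hadd _ _ (posPart_nonneg _) (add_nonneg (negPart_nonneg _) (negPart_nonneg _)),
      hadd _ _ (negPart_nonneg _) (add_nonneg (posPart_nonneg _) (posPart_nonneg _)),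
      hadd _ _ (negPart_nonneg _) (negPart_nonneg _),
      hadd _ _ (posPart_nonneg _) (posPart_nonneg _)] at h'
    linarith)
  have hq : ∀ x, ‖q x‖ ≤ (2 * |C|) * ‖x‖ := by
    intro x
    have key : ∀ y, 0 ≤ y → ‖y‖ ≤ ‖x‖ → |p y| ≤ |C| * ‖x‖ := fun y hy hyx =>
      (hb y hy).trans (mul_le_mul (le_abs_self C) hyx (norm_nonneg y) (abs_nonneg C))
    have h1 := key _ (posPart_nonneg x) (norm_posPart_le x)
    have h2 := key _ (negPart_nonneg x) (norm_negPart_le x)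
    have h3 : ‖q x‖ ≤ |p x⁺| + |p x⁻| := abs_sub _ _
    linarith
  refine ⟨q.toRealLinearMap (AddMonoidHomClass.continuous_of_bound q _ hq), fun x hx => ?_⟩
  have h0 : p 0 = 0 := by simpa using hadd 0 0 le_rfl le_rfl
  change p x⁺ - p x⁻ = p x
  rw [posPart_eq_self.2 hx, negPart_eq_zero.2 hx, h0, sub_zero]

theorem apply_mono_of_nonneg {φ : StrongDual ℝ E} (hφ : 0 ≤ φ) {x y : E} (h : x ≤ y) :
    φ x ≤ φ y := by
  have := hφ (y - x) (sub_nonneg.2 h)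
  rw [map_sub] at this
  simpa using this

theorem abs_apply_le_of_nonneg {φ : StrongDual ℝ E} (hφ : 0 ≤ φ) (x : E) : |φ x| ≤ φ |x| := by
  refine abs_le.2 ⟨?_, apply_mono_of_nonneg hφ (le_abs_self x)⟩
  have := apply_mono_of_nonneg hφ (neg_le_abs x)
  rw [map_neg] at this
  linarith

theorem norm_le_norm_of_nonneg_of_le [HasSolidNorm E] {φ ψ : StrongDual ℝ E} (hφ : 0 ≤ φ)
    (h : φ ≤ ψ) : ‖φ‖ ≤ ‖ψ‖ := by
  refine φ.opNorm_le_bound (norm_nonneg ψ) fun x => ?_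
  calc ‖φ x‖ ≤ φ |x| := abs_apply_le_of_nonneg hφ x
    _ ≤ ψ |x| := h _ (abs_nonneg x)
    _ ≤ ‖ψ |x|‖ := le_abs_self _
    _ ≤ ‖ψ‖ * ‖|x|‖ := ψ.le_opNorm _
    _ = ‖ψ‖ * ‖x‖ := by rw [norm_abs_eq_norm]

/-- Every functional `f` lies below a positive one, namely its positive part, given on the cone by
`x ↦ sup {f y | 0 ≤ y ≤ x}`. -/
theorem exists_nonneg_ge [HasSolidNorm E] (f : StrongDual ℝ E) :
    ∃ g : StrongDual ℝ E, 0 ≤ g ∧ f ≤ g := by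
  have hbd : ∀ x, ∀ r ∈ f '' Icc 0 x, r ≤ ‖f‖ * ‖x‖ := by
    rintro x _ ⟨y, hy, rfl⟩
    refine (le_abs_self _).trans ((f.le_opNorm y).trans ?_)
    refine mul_le_mul_of_nonneg_left (norm_le_norm_of_abs_le_abs ?_) (norm_nonneg f)
    rw [abs_of_nonneg hy.1, abs_of_nonneg (hy.1.trans hy.2)]
    exact hy.2
  have hbdd : ∀ x, BddAbove (f '' Icc 0 x) := fun x => ⟨_, hbd x⟩
  have hne : ∀ x : E, 0 ≤ x → (f '' Icc 0 x).Nonempty := fun x hx => ⟨_, 0, ⟨le_rfl, hx⟩, rfl⟩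
  have hnn : ∀ x : E, 0 ≤ x → 0 ≤ sSup (f '' Icc 0 x) := fun x hx =>
    le_csSup (hbdd x) ⟨0, ⟨le_rfl, hx⟩, map_zero f⟩
  obtain ⟨g, hg⟩ := exists_strongDual_eqOn_cone (fun x => sSup (f '' Icc 0 x)) ‖f‖
    (by
      intro x y hx hy
      have : f '' Icc 0 (x + y) = f '' Icc 0 x + f '' Icc 0 y := by
        rw [← image_add]
        congr 1
        ext z
        constructor
        · rintro ⟨hz, hzxy⟩
          obtain ⟨a, b, ha, hax, hb, hby, rfl⟩ := exists_add_eq_of_le_add hy hz hx hzxy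
          exact add_mem_add ⟨ha, hax⟩ ⟨hb, hby⟩
        · rintro ⟨a, ha, b, hb, rfl⟩
          exact ⟨add_nonneg ha.1 hb.1, add_le_add ha.2 hb.2⟩
      simp only [this]
      exact csSup_add (hne x hx) (hbdd x) (hne y hy) (hbdd y))
    (by
      intro x hx
      rw [abs_of_nonneg (hnn x hx)]
      exact csSup_le (hne x hx) (hbd x))
  refine ⟨g, fun x hx => ?_, fun x hx => ?_⟩
  · rw [hg x hx]; exact hnn x hx
  · rw [hg x hx]; exact le_csSup (hbdd x) ⟨x, ⟨hx, le_rfl⟩, rfl⟩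

/-- Every functional is dominated by a positive one. -/
theorem exists_nonneg_abs_apply_le [HasSolidNorm E] (f : StrongDual ℝ E) :
    ∃ g : StrongDual ℝ E, 0 ≤ g ∧ ∀ x, |f x| ≤ g |x| := by
  obtain ⟨g₁, h₁, hf₁⟩ := exists_nonneg_ge f
  obtain ⟨g₂, h₂, hf₂⟩ := exists_nonneg_ge (-f)
  refine ⟨g₁ + g₂, fun x hx => add_nonneg (h₁ x hx) (h₂ x hx), fun x => ?_⟩
  have key : ∀ y : E, 0 ≤ y → |f y| ≤ (g₁ + g₂) y := by
    intro y hy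
    have a1 : 0 ≤ g₁ y := h₁ y hy
    have a2 : 0 ≤ g₂ y := h₂ y hy
    have a3 : f y ≤ g₁ y := hf₁ y hy
    have a4 : -f y ≤ g₂ y := hf₂ y hy
    change |f y| ≤ g₁ y + g₂ y
    exact abs_le.2 ⟨by linarith, by linarith⟩
  calc |f x| = |f x⁺ - f x⁻| := by rw [← map_sub, posPart_sub_negPart]
    _ ≤ |f x⁺| + |f x⁻| := abs_sub _ _
    _ ≤ (g₁ + g₂) x⁺ + (g₁ + g₂) x⁻ :=
      add_le_add (key _ (posPart_nonneg x)) (key _ (negPart_nonneg x))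
    _ = (g₁ + g₂) |x| := by rw [← map_add, posPart_add_negPart]

/-! ### Order continuity of the dual norm and disjoint sequences -/

/-- In a dual with order continuous norm, an increasing order bounded sequence of positive
functionals is norm convergent. -/
theorem IsOrderContinuousNorm.cauchySeq_of_monotone [HasSolidNorm E]
    (hoc : IsOrderContinuousNorm (StrongDual ℝ E)) {ψ : ℕ → StrongDual ℝ E} {φ : StrongDual ℝ E}
    (hpos : ∀ n, 0 ≤ ψ n) (hmono : Monotone ψ) (hle : ∀ n, ψ n ≤ φ) : CauchySeq ψ := by
  have hlim : ∀ x, 0 ≤ x → Tendsto (fun n => ψ n x) atTop (𝓝 (⨆ n, ψ n x)) := fun x hx =>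
    tendsto_atTop_ciSup (fun m n h => hmono h x hx) ⟨φ x, by rintro _ ⟨n, rfl⟩; exact hle n x hx⟩
  obtain ⟨χ, hχ⟩ := exists_strongDual_eqOn_cone (fun x => ⨆ n, ψ n x) ‖φ‖
    (by
      intro x y hx hy
      refine tendsto_nhds_unique (hlim _ (add_nonneg hx hy)) ?_
      simpa only [map_add] using (hlim x hx).add (hlim y hy))
    (by
      intro x hx
      have h0 : 0 ≤ ⨆ n, ψ n x := ge_of_tendsto' (hlim x hx) fun n => hpos n x hx
      rw [abs_of_nonneg h0]
      exact (le_of_tendsto' (hlim x hx) fun n => hle n x hx).trans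
        ((le_abs_self _).trans (φ.le_opNorm x)))
  have hlim' : ∀ x, 0 ≤ x → Tendsto (fun n => (χ - ψ n) x) atTop (𝓝 0) := by
    intro x hx
    have h := (tendsto_const_nhds (x := χ x)).sub (hlim x hx)
    rw [← hχ x hx, sub_self] at h
    exact h
  -- The index set is lifted to the universe over which `IsOrderContinuousNorm` quantifies.
  have hanti : Antitone fun n : ULift ℕ => χ - ψ n.down := fun m n h x hx =>
    sub_le_sub_left (hmono h x hx) (χ x)
  have hglb : IsGLB (range fun n : ULift ℕ => χ - ψ n.down) 0 := by
    constructor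
    · rintro _ ⟨n, rfl⟩ x hx
      have h : ψ n.down x ≤ χ x := by
        rw [hχ x hx]
        exact Monotone.ge_of_tendsto (fun i j hij => hmono hij x hx) (hlim x hx) n.down
      exact sub_nonneg.2 h
    · intro ξ hξ x hx
      exact ge_of_tendsto' (hlim' x hx) fun n => hξ ⟨⟨n⟩, rfl⟩ x hx
  have hup : Tendsto (fun n : ℕ => (ULift.up n : ULift ℕ)) atTop atTop :=
    tendsto_atTop_atTop.2 fun b => ⟨b.down, fun a ha => ha⟩
  have hnorm := (hoc (ULift ℕ) _ hanti hglb).comp hup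
  have : Tendsto ψ atTop (𝓝 χ) := by
    rw [tendsto_iff_norm_sub_tendsto_zero]
    simpa only [norm_sub_rev χ, Function.comp_def] using hnorm
  exact this.cauchySeq

/-- The component of a positive functional `φ` carried by the band generated by `e ≥ 0`, given on
the cone by `x ↦ sup_k φ (x ⊓ k e)`. -/
theorem exists_component [HasSolidNorm E] {φ : StrongDual ℝ E} (hφ : 0 ≤ φ) {e : E} (he : 0 ≤ e) :
    ∃ ψ : StrongDual ℝ E, 0 ≤ ψ ∧ ψ e = φ e ∧
      ∀ x, 0 ≤ x → Tendsto (fun k : ℕ => φ (x ⊓ k • e)) atTop (𝓝 (ψ x)) := by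
  have hle : ∀ (x : E) (k : ℕ), φ (x ⊓ k • e) ≤ φ x := fun x k => apply_mono_of_nonneg hφ inf_le_left
  have hbdd : ∀ x : E, BddAbove (range fun k : ℕ => φ (x ⊓ k • e)) := fun x =>
    ⟨φ x, by rintro _ ⟨k, rfl⟩; exact hle x k⟩
  have hmono : ∀ x : E, Monotone fun k : ℕ => φ (x ⊓ k • e) := fun x k l h =>
    apply_mono_of_nonneg hφ (inf_le_inf_left x (nsmul_le_nsmul_left he h))
  have hlim : ∀ x : E, Tendsto (fun k : ℕ => φ (x ⊓ k • e)) atTop (𝓝 (⨆ k : ℕ, φ (x ⊓ k • e))) :=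
    fun x => tendsto_atTop_ciSup (hmono x) (hbdd x)
  have hnn : ∀ x, 0 ≤ x → ∀ k : ℕ, 0 ≤ φ (x ⊓ k • e) := fun x hx k =>
    hφ _ (le_inf hx (nsmul_nonneg he k))
  obtain ⟨ψ, hψ⟩ := exists_strongDual_eqOn_cone (fun x => ⨆ k : ℕ, φ (x ⊓ k • e)) ‖φ‖
    (by
      intro x y hx hy
      apply le_antisymm
      · refine le_of_tendsto_of_tendsto' (hlim (x + y)) ((hlim x).add (hlim y)) fun k => ?_
        rw [← map_add]
        exact apply_mono_of_nonneg hφ (add_inf_le_inf_add_inf hx hy (nsmul_nonneg he k))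
      · refine le_of_tendsto' ((hlim x).add (hlim y)) fun k => ?_
        rw [← map_add]
        refine le_trans (apply_mono_of_nonneg hφ (le_inf ?_ ?_)) (le_ciSup (hbdd (x + y)) (k + k))
        · exact add_le_add inf_le_left inf_le_left
        · rw [add_nsmul]
          exact add_le_add inf_le_right inf_le_right)
    (by
      intro x hx
      rw [abs_of_nonneg (ge_of_tendsto' (hlim x) (hnn x hx))]
      exact (le_of_tendsto' (hlim x) (hle x)).trans ((le_abs_self _).trans (φ.le_opNorm x)))
  refine ⟨ψ, fun x hx => ?_, ?_, fun x hx => ?_⟩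
  · rw [hψ x hx]
    exact ge_of_tendsto' (hlim x) (hnn x hx)
  · rw [hψ e he]
    refine le_antisymm (le_of_tendsto' (hlim e) (hle e)) ?_
    simpa using le_ciSup (hbdd e) 1
  · rw [hψ x hx]
    exact hlim x

/-- If the dual norm is order continuous, then bounded disjoint positive sequences are weakly null.
The components of `φ` on the bands generated by the `e n` have sums below `φ`, so they tend to `0`
in norm. -/
theorem IsOrderContinuousNorm.tendsto_apply_of_disjoint [HasSolidNorm E]
    (hoc : IsOrderContinuousNorm (StrongDual ℝ E)) {φ : StrongDual ℝ E} (hφ : 0 ≤ φ) {e : ℕ → E}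
    (he : ∀ n, 0 ≤ e n) (hball : ∀ n, ‖e n‖ ≤ 1) (hd : ∀ m n, m ≠ n → e m ⊓ e n = 0) :
    Tendsto (fun n => φ (e n)) atTop (𝓝 0) := by
  choose ψ hψ0 hψe hψ using fun n => exists_component hφ (he n)
  have hdk : ∀ k : ℕ, ∀ m n, m ≠ n → (k • e m) ⊓ (k • e n) = 0 := fun k m n hmn =>
    nsmul_inf_eq_zero (he m) (nsmul_nonneg (he n) k)
      (by rw [inf_comm]; exact nsmul_inf_eq_zero (he n) (he m) (hd n m hmn.symm) k) k
  have hcs : CauchySeq fun N => ∑ n ∈ Finset.range N, ψ n := by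
    refine hoc.cauchySeq_of_monotone (φ := φ) (fun N x hx => ?_) (monotone_nat_of_le_succ ?_)
      fun N x hx => ?_
    · rw [_root_.sum_apply]
      exact Finset.sum_nonneg fun n _ => hψ0 n x hx
    · intro N x hx
      rw [Finset.sum_range_succ]
      exact le_add_of_nonneg_right (hψ0 N x hx)
    · rw [_root_.sum_apply]
      refine le_of_tendsto' (tendsto_finsetSum _ fun n _ => hψ n x hx) fun k => ?_
      rw [← map_sum]
      refine apply_mono_of_nonneg hφ (sum_le_of_disjoint hx
        (fun n => le_inf hx (nsmul_nonneg (he n) k)) (fun n => inf_le_left) (fun m n hmn => ?_) N)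
      refine le_antisymm ?_ (le_inf (le_inf hx (nsmul_nonneg (he m) k))
        (le_inf hx (nsmul_nonneg (he n) k)))
      rw [← hdk k m n hmn]
      exact inf_le_inf inf_le_right inf_le_right
  have h0 : Tendsto (fun n => ‖ψ n‖) atTop (𝓝 0) := by
    rw [Metric.tendsto_atTop]
    intro ε hε
    obtain ⟨N, hN⟩ := Metric.cauchySeq_iff.1 hcs ε hε
    refine ⟨N, fun n hn => ?_⟩
    simpa [dist_eq_norm, Finset.sum_range_succ] using hN (n + 1) (by omega) n hn
  refine squeeze_zero (fun n => hφ _ (he n)) (fun n => ?_) h0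
  rw [← hψe n]
  calc ψ n (e n) ≤ ‖ψ n‖ * ‖e n‖ := (le_abs_self _).trans ((ψ n).le_opNorm _)
    _ ≤ ‖ψ n‖ := mul_le_of_le_one_right (norm_nonneg _) (hball n)

end Dual

/-! ### A gliding hump inside an order interval -/

section GlidingHump

variable {F : Type*} [NormedAddCommGroup F] [NormedSpace ℝ F] [Lattice F] [IsOrderedAddMonoid F]

/-- One step of the gliding hump: inside `[0, u]` one can move from `s` to a point where `f` is
large, without moving by more than `w`. -/
theorem exists_mem_Icc_abs_apply_ge {u w s : F} {f : StrongDual ℝ F} {δ : ℝ}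
    (hw : w ∈ Icc 0 u) (hs : s ∈ Icc 0 u) (hfw : 4 * δ ≤ |f w|) (hfs : |f s| ≤ δ) :
    ∃ s' ∈ Icc 0 u, |s' - s| ≤ w ∧ δ ≤ |f s'| := by
  -- `w ≤ w ⊓ s + w ⊓ (u - s)`: one summand can be subtracted from `s`, the other one added to `s`.
  have hwle : w ≤ s ⊓ w + (u - s) ⊓ w := by
    have h := add_inf_le_inf_add_inf hs.1 (sub_nonneg.2 hs.2) hw.1
    rwa [add_sub_cancel, inf_eq_right.2 hw.2] at h
  obtain ⟨a, b, ha, has, hb, hbs, hab⟩ := exists_add_eq_of_le_add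
    (le_inf (sub_nonneg.2 hs.2) hw.1) hw.1 (le_inf hs.1 hw.1) hwle
  have hsum : 4 * δ ≤ |f a| + |f b| := by
    rw [← hab, map_add] at hfw
    exact hfw.trans (abs_add_le _ _)
  -- The larger of `|f a|`, `|f b|` is at least `2 δ`, of which `|f s|` cancels at most `δ`.
  rcases le_total (|f b|) (|f a|) with h | h
  · refine ⟨s - a, ⟨sub_nonneg.2 (has.trans inf_le_left), (sub_le_self s ha).trans hs.2⟩, ?_, ?_⟩
    · rw [sub_sub_cancel_left, abs_neg, abs_of_nonneg ha]
      exact has.trans inf_le_right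
    · rw [map_sub, abs_sub_comm]
      linarith [abs_sub_abs_le_abs_sub (f a) (f s)]
  · refine ⟨s + b, ⟨add_nonneg hs.1 hb, ?_⟩, ?_, ?_⟩
    · exact le_sub_iff_add_le'.1 (hbs.trans inf_le_left)
    · rw [add_sub_cancel_left, abs_of_nonneg hb]
      exact hbs.trans inf_le_right
    · rw [map_add, add_comm]
      have := abs_sub_abs_le_abs_sub (f b) (-f s)
      rw [abs_neg, sub_neg_eq_add] at this
      linarith

/-- If `0 ≤ w n ≤ u`, every positive functional tends to `0` along `w`, and `f n → 0` weakly in the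
dual, then `f n (w n) → 0`. Otherwise a gliding hump produces a sequence in `[0, u]` whose weak-star
cluster points in the bidual stay away from `0` on infinitely many `f n`. -/
theorem tendsto_apply_of_weaklyNull [HasSolidNorm F] {u : F} {w : ℕ → F} {f : ℕ → StrongDual ℝ F}
    (hw : ∀ n, w n ∈ Icc 0 u)
    (hnull : ∀ g : StrongDual ℝ F, 0 ≤ g → Tendsto (fun n => g (w n)) atTop (𝓝 0))
    (hf : ∀ Φ : StrongDual ℝ (StrongDual ℝ F), Tendsto (fun n => Φ (f n)) atTop (𝓝 0)) :
    Tendsto (fun n => f n (w n)) atTop (𝓝 0) := by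
  by_contra hcon
  obtain ⟨δ, hδ, hfreq⟩ : ∃ δ > 0, ∃ᶠ n in atTop, 4 * δ ≤ |f n (w n)| := by
    simp only [Metric.tendsto_nhds, not_forall, not_eventually, Real.dist_0_eq_abs, not_lt] at hcon
    obtain ⟨ε, hε, h⟩ := hcon
    exact ⟨ε / 4, by linarith, h.mono fun n hn => by linarith⟩
  have hdom : ∀ g : StrongDual ℝ F, ∀ η > 0, ∀ᶠ n in atTop, ∀ d, |d| ≤ w n → |g d| ≤ η := by
    intro g η hη
    obtain ⟨G, hG, hgG⟩ := exists_nonneg_abs_apply_le g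
    filter_upwards [(hnull G hG).eventually (ge_mem_nhds hη)] with n hn d hd
    exact (hgG d).trans ((apply_mono_of_nonneg hG hd).trans hn)
  have step : ∀ q : ℕ × Icc (0 : F) u, ∃ q' : ℕ × Icc (0 : F) u, q.1 < q'.1 ∧
      δ ≤ |f q'.1 q'.2| ∧ ∀ i ≤ q.1, |f i (q'.2 - q.2)| ≤ δ / 4 * (1 / 2) ^ q.1 := by
    rintro ⟨n, s, hs⟩
    have h1 : ∀ᶠ m in atTop, ∀ i ∈ Finset.range (n + 1), ∀ d, |d| ≤ w m →
        |f i d| ≤ δ / 4 * (1 / 2) ^ n :=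
      (Finset.eventually_all _).2 fun i _ => hdom (f i) _ (by positivity)
    have h2 : ∀ᶠ m in atTop, |f m s| ≤ δ := by
      have h := hf (NormedSpace.inclusionInDoubleDual ℝ F s)
      simp only [NormedSpace.dual_def] at h
      have h' := h.abs
      rw [abs_zero] at h'
      exact h'.eventually (ge_mem_nhds hδ)
    obtain ⟨m, hm, hm1, hm2, hmn⟩ :=
      (hfreq.and_eventually (h1.and (h2.and (eventually_gt_atTop n)))).exists
    obtain ⟨s', hs', hss', hfs'⟩ := exists_mem_Icc_abs_apply_ge (hw m) hs hm hm2
    exact ⟨(m, ⟨s', hs'⟩), hmn, hfs', fun i hi =>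
      hm1 i (Finset.mem_range.2 (Nat.lt_succ_of_le hi)) _ hss'⟩
  choose next hnext1 hnext2 hnext3 using step
  have hu : (0 : F) ≤ u := (hw 0).1.trans (hw 0).2
  let q : ℕ → ℕ × Icc (0 : F) u := fun k => Nat.rec (0, ⟨0, le_rfl, hu⟩) (fun _ p => next p) k
  have hq : ∀ k, q (k + 1) = next (q k) := fun k => rfl
  have hmono : StrictMono fun k => (q k).1 := strictMono_nat_of_lt_succ fun k => by
    rw [hq]; exact hnext1 _
  -- The steps after the `k`-th one move the value of the `k`-th functional by at most `δ / 2`.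
  have hdrift : ∀ k j, k ≤ j →
      |f (q k).1 ((q j).2 - (q k).2)| ≤ δ / 2 * (1 - (1 / 2) ^ j) := by
    intro k j hkj
    induction j, hkj using Nat.le_induction with
    | base =>
      rw [sub_self, map_zero, abs_zero]
      have : (1 / 2 : ℝ) ^ k ≤ 1 := pow_le_one₀ (by norm_num) (by norm_num)
      exact mul_nonneg (by linarith) (by linarith)
    | succ j hkj ih =>
      have h1 := hnext3 (q j) (q k).1 (hmono.monotone hkj)
      rw [← hq] at h1
      have h2 : (1 / 2 : ℝ) ^ (q j).1 ≤ (1 / 2) ^ j :=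
        pow_le_pow_of_le_one (by norm_num) (by norm_num) (hmono.le_apply)
      have h3 : δ / 4 * (1 / 2 : ℝ) ^ (q j).1 ≤ δ / 4 * (1 / 2) ^ j :=
        mul_le_mul_of_nonneg_left h2 (by linarith)
      have h4 : ((q (j + 1)).2 - (q k).2 : F)
          = ((q (j + 1)).2 - (q j).2) + ((q j).2 - (q k).2) := by abel
      rw [h4, map_add]
      refine (abs_add_le _ _).trans ?_
      rw [pow_succ]
      linarith
  have hlarge : ∀ k j, k + 1 ≤ j → δ / 2 ≤ |f (q (k + 1)).1 (q j).2| := by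
    intro k j hkj
    have h1 := hdrift (k + 1) j hkj
    have h2 : δ ≤ |f (q (k + 1)).1 (q (k + 1)).2| := by rw [hq]; exact hnext2 _
    have h3 := abs_sub_abs_le_abs_sub (f (q (k + 1)).1 (q (k + 1)).2) (f (q (k + 1)).1 (q j).2)
    rw [abs_sub_comm, ← map_sub] at h3
    have h4 : 0 ≤ δ / 2 * (1 / 2) ^ j := by positivity
    linarith
  let U : Ultrafilter ℕ := Ultrafilter.of atTop
  have hU : (U : Filter ℕ) ≤ atTop := Ultrafilter.of_le _
  let J : ℕ → WeakDual ℝ (StrongDual ℝ F) := fun j =>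
    StrongDual.toWeakDual (NormedSpace.inclusionInDoubleDual ℝ F ((q j).2 : F))
  have hJ : ∀ j, J j ∈ WeakDual.toStrongDual ⁻¹' Metric.closedBall
      (0 : StrongDual ℝ (StrongDual ℝ F)) ‖u‖ := by
    intro j
    refine (dist_zero_right (NormedSpace.inclusionInDoubleDual ℝ F ((q j).2 : F))).trans_le ?_
    refine (NormedSpace.double_dual_bound ℝ F _).trans (norm_le_norm_of_abs_le_abs ?_)
    rw [abs_of_nonneg (q j).2.2.1, abs_of_nonneg hu]
    exact (q j).2.2.2
  obtain ⟨Φ, -, hΦ⟩ := (WeakDual.isCompact_closedBall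
    (0 : StrongDual ℝ (StrongDual ℝ F)) ‖u‖).ultrafilter_le_nhds (U.map J)
      (le_principal_iff.2 (Ultrafilter.mem_map.2 (univ_mem' hJ)))
  have hev : ∀ g : StrongDual ℝ F, Tendsto (fun j => g ((q j).2 : F)) U (𝓝 (Φ g)) := fun g =>
    ((WeakDual.eval_continuous g).tendsto Φ).comp hΦ
  have hΦlarge : ∀ k, δ / 2 ≤ |Φ (f (q (k + 1)).1)| := fun k =>
    ge_of_tendsto (hev _).abs (hU ((eventually_ge_atTop (k + 1)).mono fun j hj => hlarge k j hj))
  have hsub := ((hf (WeakDual.toStrongDual Φ)).comp hmono.tendsto_atTop).comp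
    (tendsto_add_atTop_nat 1)
  have h0 := ge_of_tendsto' hsub.abs hΦlarge
  rw [abs_zero] at h0
  linarith

end GlidingHump

/-! ### Semi-compact operators -/

theorem IsWeaklyConvergentSeq.exists_tendsto {V : Type*} [NormedAddCommGroup V] [NormedSpace ℝ V]
    {f : ℕ → V} (hf : IsWeaklyConvergentSeq f) :
    ∃ g, ∀ Φ : StrongDual ℝ V, Tendsto (fun n => Φ (f n)) atTop (𝓝 (Φ g)) := by
  obtain ⟨g, hg⟩ := hf
  exact ⟨g, fun Φ => ((WeakBilin.eval_continuous _ Φ).tendsto _).comp hg⟩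

/-- Truncating at `u` the positive part of a point of `[-u, u] + ε B` costs at most `ε` in norm. -/
theorem norm_posPart_sub_inf_le {F : Type*} [NormedAddCommGroup F] [Lattice F]
    [IsOrderedAddMonoid F] [HasSolidNorm F] {u y a e : F} (hu : 0 ≤ u) (ha : a ≤ u) (h : a + e = y) :
    ‖y⁺ - y⁺ ⊓ u‖ ≤ ‖e‖ := by
  have h0 : 0 ≤ y⁺ - y⁺ ⊓ u := sub_nonneg.2 inf_le_left
  refine norm_le_norm_of_abs_le_abs ?_
  rw [abs_of_nonneg h0, sub_le_comm]
  refine le_inf (sub_le_self _ (abs_nonneg e)) (sub_le_iff_le_add.2 ?_)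
  rw [posPart_def, ← h]
  exact sup_le (add_le_add ha (le_abs_self e)) (add_nonneg hu (abs_nonneg e))

/-- Rank one operators `φ ⊗ y` with `y ≥ 0` are semi-compact. -/
theorem isSemiCompact_smulRight {X F : Type*} [NormedAddCommGroup X] [NormedSpace ℝ X]
    [NormedAddCommGroup F] [NormedSpace ℝ F] [Lattice F] [IsOrderedAddMonoid F]
    [IsOrderedModule ℝ F] (φ : StrongDual ℝ X) {y : F} (hy : 0 ≤ y) :
    (φ.smulRight y : X →L[ℝ] F).IsSemiCompact := by
  intro ε hε
  refine ⟨‖φ‖ • y, smul_nonneg (norm_nonneg _) hy, ?_⟩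
  rintro _ ⟨x, hx, rfl⟩
  have hφx : |φ x| ≤ ‖φ‖ :=
    (φ.le_opNorm x).trans (mul_le_of_le_one_right (norm_nonneg _) (mem_closedBall_zero_iff.1 hx))
  refine ⟨φ x • y, ⟨?_, ?_⟩, 0, ⟨0, by simp, by simp⟩, by simp⟩
  · rw [← neg_smul]
    exact smul_le_smul_of_nonneg_right (abs_le.1 hφx).1 hy
  · exact smul_le_smul_of_nonneg_right (abs_le.1 hφx).2 hy

section SemiCompact

variable {E : Type*} [NormedAddCommGroup E] [NormedSpace ℝ E] [Lattice E] [IsOrderedAddMonoid E]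
  {F : Type*} [NormedAddCommGroup F] [NormedSpace ℝ F] [Lattice F] [IsOrderedAddMonoid F]

theorem ContinuousLinearMap.abs_apply_le_of_nonneg {T : E →L[ℝ] F}
    (hT : ∀ x : E, 0 ≤ x → 0 ≤ T x) (x : E) : |T x| ≤ T |x| := by
  refine abs_le'.2 ⟨?_, ?_⟩
  · rw [← sub_nonneg, ← map_sub]
    exact hT _ (sub_nonneg.2 (le_abs_self x))
  · rw [← sub_nonneg, sub_neg_eq_add, ← map_add]
    exact hT _ (by rw [← sub_neg_eq_add]; exact sub_nonneg.2 (neg_le_abs x))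

/-- If positive functionals tend to `0` along disjoint sequences of the unit ball, then positive
semi-compact operators are almost M-weakly compact. -/
theorem ContinuousLinearMap.IsSemiCompact.isAlmostMWeaklyCompact [HasSolidNorm E]
    [HasSolidNorm F] [CompleteSpace F] {T : E →L[ℝ] F}
    (hT : ∀ x : E, 0 ≤ x → 0 ≤ T x) (hsc : T.IsSemiCompact)
    (hdisj : ∀ φ : StrongDual ℝ E, 0 ≤ φ → ∀ x : ℕ → E, (∀ n, ‖x n‖ ≤ 1) → IsDisjointSeq x →
      Tendsto (fun n => φ |x n|) atTop (𝓝 0)) : T.IsAlmostMWeaklyCompact := by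
  intro x f hx hxd hf
  obtain ⟨g, hg⟩ := hf.exists_tendsto
  have hxn : ∀ n, ‖x n‖ ≤ 1 := fun n => mem_closedBall_zero_iff.1 (hx n)
  have hnull : ∀ G : StrongDual ℝ F, 0 ≤ G → Tendsto (fun n => G (T |x n|)) atTop (𝓝 0) :=
    fun G hG => hdisj (G ∘L T) (fun y hy => hG _ (hT y hy)) x hxn hxd
  have hg0 : Tendsto (fun n => g (T (x n))) atTop (𝓝 0) := by
    obtain ⟨G, hG, hgG⟩ := exists_nonneg_abs_apply_le g
    exact squeeze_zero_norm (fun n => (hgG _).trans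
      (apply_mono_of_nonneg hG (T.abs_apply_le_of_nonneg hT (x n)))) (hnull G hG)
  let h : ℕ → StrongDual ℝ F := fun n => f n - g
  have hh : ∀ Φ : StrongDual ℝ (StrongDual ℝ F), Tendsto (fun n => Φ (h n)) atTop (𝓝 0) := by
    intro Φ
    have := (hg Φ).sub (tendsto_const_nhds (x := Φ g))
    simpa only [h, map_sub, sub_self] using this
  obtain ⟨M, hM⟩ : ∃ M, ∀ n, ‖h n‖ ≤ M := by
    refine banach_steinhaus fun y => ?_
    obtain ⟨C, hC⟩ := (Metric.isBounded_range_of_tendsto _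
      (hh (NormedSpace.inclusionInDoubleDual ℝ F y))).exists_norm_le
    exact ⟨C, fun n => hC _ ⟨n, rfl⟩⟩
  have hM0 : 0 ≤ M := (norm_nonneg _).trans (hM 0)
  have hmain : Tendsto (fun n => h n (T (x n))) atTop (𝓝 0) := by
    rw [Metric.tendsto_nhds]
    intro η hη
    obtain ⟨u, hu, hsub⟩ := hsc (η / (4 * (M + 1))) (by positivity)
    -- The part of `T (x n)` truncated at `u` is handled by the gliding hump, the rest is small.
    have htrunc : ∀ y : ℕ → F, (∀ n, |y n| ≤ T |x n|) →
        Tendsto (fun n => h n ((y n)⁺ ⊓ u)) atTop (𝓝 0) := by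
      intro y hy
      refine tendsto_apply_of_weaklyNull (u := u)
        (fun n => ⟨le_inf (posPart_nonneg _) hu, inf_le_right⟩) (fun G hG => ?_) hh
      refine squeeze_zero (fun n => hG _ (le_inf (posPart_nonneg _) hu))
        (fun n => apply_mono_of_nonneg hG ?_) (hnull G hG)
      exact inf_le_left.trans ((sup_le (le_abs_self _) (abs_nonneg _)).trans (hy n))
    have hTx : ∀ n, |T (x n)| ≤ T |x n| := fun n => T.abs_apply_le_of_nonneg hT (x n)
    have h1 := (htrunc (fun n => T (x n)) hTx).sub
      (htrunc (fun n => -T (x n)) fun n => by rw [abs_neg]; exact hTx n)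
    rw [sub_zero, Metric.tendsto_nhds] at h1
    filter_upwards [h1 (η / 2) (by linarith)] with n hn
    rw [Real.dist_0_eq_abs] at hn ⊢
    obtain ⟨a, ha, e, he, hae⟩ := hsub ⟨x n, hx n, rfl⟩
    obtain ⟨b, hb, rfl⟩ := he
    rw [mem_closedBall_zero_iff] at hb
    have hε : ‖(η / (4 * (M + 1))) • b‖ ≤ η / (4 * (M + 1)) := by
      rw [norm_smul, Real.norm_of_nonneg (by positivity)]
      exact mul_le_of_le_one_right (by positivity) hb
    have hp := norm_posPart_sub_inf_le hu ha.2 hae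
    have hm := norm_posPart_sub_inf_le (y := -T (x n)) (a := -a) (e := -((η / (4 * (M + 1))) • b))
      hu (neg_le.1 ha.1) (by rw [← hae]; exact (neg_add _ _).symm)
    rw [norm_neg] at hm
    have hbound : ∀ z : F, ‖z‖ ≤ η / (4 * (M + 1)) → |h n z| < η / 4 := by
      intro z hz
      calc |h n z| ≤ ‖h n‖ * ‖z‖ := (h n).le_opNorm z
        _ ≤ M * (η / (4 * (M + 1))) := mul_le_mul (hM n) hz (norm_nonneg _) hM0
        _ < (M + 1) * (η / (4 * (M + 1))) :=
          mul_lt_mul_of_pos_right (lt_add_one M) (by positivity)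
        _ = η / 4 := by field_simp
    have hp' := hbound _ (hp.trans hε)
    have hm' := hbound _ (hm.trans hε)
    have hdecomp : T (x n) = ((T (x n))⁺ - (T (x n))⁺ ⊓ u) - ((-T (x n))⁺ - (-T (x n))⁺ ⊓ u)
        + ((T (x n))⁺ ⊓ u - (-T (x n))⁺ ⊓ u) := by
      nth_rw 1 [← posPart_sub_negPart (T (x n))]
      rw [posPart_neg]
      abel
    rw [hdecomp, map_add, map_sub, map_sub (h n) ((T (x n))⁺ ⊓ u)]
    refine (abs_add_le _ _).trans_lt ?_
    have := abs_sub (h n ((T (x n))⁺ - (T (x n))⁺ ⊓ u)) (h n ((-T (x n))⁺ - (-T (x n))⁺ ⊓ u))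
    linarith
  simpa [h] using hmain.add hg0

/-- Testing almost M-weak compactness on rank one operators and constant sequences of functionals
shows that bounded disjoint sequences are null for positive functionals. -/
theorem tendsto_apply_of_forall_isAlmostMWeaklyCompact [HasSolidNorm F] [IsOrderedModule ℝ F]
    [Nontrivial F]
    (H : ∀ T : E →L[ℝ] F, (∀ x : E, 0 ≤ x → 0 ≤ T x) → T.IsSemiCompact →
      T.IsAlmostMWeaklyCompact) {φ : StrongDual ℝ E} (hφ : 0 ≤ φ) {x : ℕ → E}
    (hx : ∀ n, ‖x n‖ ≤ 1) (hd : IsDisjointSeq x) : Tendsto (fun n => φ (x n)) atTop (𝓝 0) := by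
  obtain ⟨z, hz⟩ := exists_ne (0 : F)
  have hy : ‖|z|‖ ≠ 0 := by rwa [norm_abs_eq_norm, norm_ne_zero_iff]
  obtain ⟨f, -, hf⟩ := exists_dual_vector ℝ |z| hy
  have hf0 : f |z| ≠ 0 := by
    rw [hf]
    exact hy
  have h := H (φ.smulRight |z|) (fun x hx => smul_nonneg (hφ x hx) (abs_nonneg z))
    (isSemiCompact_smulRight φ (abs_nonneg z)) x (fun _ => f)
    (fun n => mem_closedBall_zero_iff.2 (hx n)) hd ⟨f, tendsto_const_nhds⟩
  have h' := h.mul_const (f |z|)⁻¹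
  simpa [hf0, mul_assoc] using h'

end SemiCompact

/-! ### Order continuity of the dual norm from disjoint sequences -/

section OrderContinuity

variable {E : Type*} [NormedAddCommGroup E] [NormedSpace ℝ E] [Lattice E] [IsOrderedAddMonoid E]

/-- A decreasing net of functionals with infimum `0` tends to `0` pointwise on the positive cone. -/
theorem tendsto_apply_of_isGLB [HasSolidNorm E] {ι : Type*} [Preorder ι] [IsDirectedOrder ι]
    [Nonempty ι] {φ : ι → StrongDual ℝ E} (hanti : Antitone φ) (hglb : IsGLB (range φ) 0) {x : E}
    (hx : 0 ≤ x) : Tendsto (fun i => φ i x) atTop (𝓝 0) := by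
  have hpos : ∀ i, 0 ≤ φ i := fun i => hglb.1 ⟨i, rfl⟩
  have hlim : ∀ x, 0 ≤ x → Tendsto (fun i => φ i x) atTop (𝓝 (⨅ i, φ i x)) := fun x hx =>
    tendsto_atTop_ciInf (fun i j h => hanti h x hx) ⟨0, by rintro _ ⟨i, rfl⟩; exact hpos i x hx⟩
  have hle : ∀ x, 0 ≤ x → ∀ i, ⨅ i, φ i x ≤ φ i x := fun x hx i =>
    Antitone.le_of_tendsto (fun i j h => hanti h x hx) (hlim x hx) i
  obtain ⟨i₀⟩ := ‹Nonempty ι›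
  obtain ⟨ψ, hψ⟩ := exists_strongDual_eqOn_cone (fun x => ⨅ i, φ i x) ‖φ i₀‖
    (by
      intro x y hx hy
      refine tendsto_nhds_unique (hlim _ (add_nonneg hx hy)) ?_
      simpa only [map_add] using (hlim x hx).add (hlim y hy))
    (by
      intro x hx
      rw [abs_of_nonneg (ge_of_tendsto' (hlim x hx) fun i => hpos i x hx)]
      exact (hle x hx i₀).trans ((le_abs_self _).trans ((φ i₀).le_opNorm x)))
  have hψ0 : ψ ≤ 0 := hglb.2 (by
    rintro _ ⟨i, rfl⟩ x hx
    rw [hψ x hx]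
    exact hle x hx i)
  have h0 : ⨅ i, φ i x = 0 := le_antisymm (by rw [← hψ x hx]; exact hψ0 x hx)
    (ge_of_tendsto' (hlim x hx) fun i => hpos i x hx)
  rw [← h0]
  exact hlim x hx

theorem posPart_inf_posPart_eq_zero [IsOrderedModule ℝ E] {a b : E} {c d : ℝ} (hc : 0 < c)
    (hcd : 1 ≤ c * d) (ha : 0 ≤ a) : (b - d • a)⁺ ⊓ (a - c • b)⁺ = 0 := by
  -- `(a - c b)⁺ ≤ c (d a - b)⁺`, and `c (d a - b)⁺` is a multiple of `(b - d a)⁻`.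
  obtain ⟨k, hk⟩ := exists_nat_ge c
  have h1 : (a - c • b)⁺ ≤ k • (b - d • a)⁻ := by
    have h0 : 0 ≤ (b - d • a)⁻ := negPart_nonneg _
    rw [posPart_def]
    refine sup_le ?_ (nsmul_nonneg h0 k)
    calc a - c • b ≤ (c * d) • a - c • b := by
          refine sub_le_sub_right ?_ _
          simpa using smul_le_smul_of_nonneg_right hcd ha
      _ = c • (-(b - d • a)) := by rw [neg_sub, smul_sub, mul_smul]
      _ ≤ c • (b - d • a)⁻ := smul_le_smul_of_nonneg_left (neg_le_negPart _) hc.le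
      _ ≤ (k : ℝ) • (b - d • a)⁻ := smul_le_smul_of_nonneg_right hk h0
      _ = k • (b - d • a)⁻ := Nat.cast_smul_eq_nsmul ℝ k _
  refine le_antisymm ?_ (le_inf (posPart_nonneg _) (posPart_nonneg _))
  calc (b - d • a)⁺ ⊓ (a - c • b)⁺ ≤ (b - d • a)⁺ ⊓ k • (b - d • a)⁻ := inf_le_inf_left _ h1
    _ = 0 := by
      rw [inf_comm]
      exact nsmul_inf_eq_zero (negPart_nonneg _) (posPart_nonneg _)
        (by rw [inf_comm]; exact posPart_inf_negPart_eq_zero _) k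

/-- Disjointification of a bounded positive sequence: subtracting from `x n` a large multiple of its
predecessors and a small multiple of an element dominating its successors leaves a disjoint
sequence. -/
theorem isDisjointSeq_posPart_sub [IsOrderedModule ℝ E] {x : ℕ → E} {z : E} (hx : ∀ n, 0 ≤ x n)
    (hz : ∀ n, (1 / 2 : ℝ) ^ n • x n ≤ z) :
    IsDisjointSeq fun n =>
      (x n - (4 : ℝ) ^ n • ∑ i ∈ Finset.range n, x i - (1 / 2 : ℝ) ^ n • z)⁺ := by
  have hz0 : 0 ≤ z := (smul_nonneg (by positivity) (hx 0)).trans (hz 0)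
  have key : ∀ m n, m < n →
      (x n - (4 : ℝ) ^ n • ∑ i ∈ Finset.range n, x i - (1 / 2 : ℝ) ^ n • z)⁺ ⊓
      (x m - (4 : ℝ) ^ m • ∑ i ∈ Finset.range m, x i - (1 / 2 : ℝ) ^ m • z)⁺ = 0 := by
    intro m n hmn
    refine le_antisymm ?_ (le_inf (posPart_nonneg _) (posPart_nonneg _))
    have hcd : (1 : ℝ) ≤ ((1 / 2) ^ m * (1 / 2) ^ n) * 4 ^ n := by
      have h4 : (4 : ℝ) ^ n = 2 ^ n * 2 ^ n := by rw [← mul_pow]; norm_num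
      have h2 : (2 : ℝ) ^ m ≤ 2 ^ n := pow_le_pow_right₀ (by norm_num) hmn.le
      rw [h4, one_div, inv_pow, inv_pow]
      have : ((2 : ℝ) ^ m)⁻¹ * (2 ^ n)⁻¹ * (2 ^ n * 2 ^ n) = (2 ^ m)⁻¹ * 2 ^ n := by field_simp
      rw [this, ← div_eq_inv_mul, one_le_div (by positivity)]
      exact h2
    rw [← posPart_inf_posPart_eq_zero (b := x n) (by positivity) hcd (hx m)]
    refine inf_le_inf (posPart_mono ?_) (posPart_mono ?_)
    · refine (sub_le_self _ (smul_nonneg (by positivity) hz0)).trans (sub_le_sub_left ?_ _)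
      exact smul_le_smul_of_nonneg_left
        (Finset.single_le_sum (fun i _ => hx i) (Finset.mem_range.2 hmn)) (by positivity)
    · refine sub_le_sub (sub_le_self _ (smul_nonneg (by positivity)
        (Finset.sum_nonneg fun i _ => hx i))) ?_
      rw [mul_smul]
      exact smul_le_smul_of_nonneg_left (hz n) (by positivity)
  intro m n hmn
  simp only [abs_of_nonneg (posPart_nonneg _)]
  rcases lt_or_gt_of_ne hmn with h | h
  · rw [inf_comm]
    exact key m n h
  · exact key n m h

/-- If positive functionals tend to `0` along disjoint sequences of the unit ball, then the dual norm
is order continuous. Along a decreasing net `φ` with infimum `0` and norms `≥ ε`, vectors `x n` of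
the unit ball are picked recursively with `φ (i n) (x n) ≥ ε / 2` and `φ (i n)` tiny on the predecessors;
disjointifying `x` contradicts the hypothesis for an initial term of the net. -/
theorem isOrderContinuousNorm_of_tendsto_apply [HasSolidNorm E] [CompleteSpace E]
    [IsOrderedModule ℝ E]
    (H : ∀ φ : StrongDual ℝ E, 0 ≤ φ → ∀ x : ℕ → E, (∀ n, ‖x n‖ ≤ 1) → IsDisjointSeq x →
      Tendsto (fun n => φ (x n)) atTop (𝓝 0)) : IsOrderContinuousNorm (StrongDual ℝ E) := by
  intro ι _ _ _ φ hanti hglb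
  have hpos : ∀ i, 0 ≤ φ i := fun i => hglb.1 ⟨i, rfl⟩
  by_contra hcon
  obtain ⟨ε, hε, hnorm⟩ : ∃ ε > 0, ∀ i, ε ≤ ‖φ i‖ := by
    by_contra! h
    refine hcon (Metric.tendsto_nhds.2 fun ε hε => ?_)
    obtain ⟨i, hi⟩ := h ε hε
    filter_upwards [eventually_ge_atTop i] with j hj
    rw [dist_zero_right, norm_norm]
    exact (norm_le_norm_of_nonneg_of_le (hpos j) (hanti hj)).trans_lt hi
  have hX : ∀ i, ∃ x : E, 0 ≤ x ∧ ‖x‖ ≤ 1 ∧ ε / 2 ≤ φ i x := by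
    intro i
    obtain ⟨x, hx, hφx⟩ := (φ i).exists_lt_apply_of_lt_opNorm
      (lt_of_lt_of_le (half_lt_self hε) (hnorm i))
    exact ⟨|x|, abs_nonneg x, by rw [norm_abs_eq_norm]; exact hx.le,
      hφx.le.trans (abs_apply_le_of_nonneg (hpos i) x)⟩
  choose X hX0 hX1 hX2 using hX
  obtain ⟨i₀⟩ := ‹Nonempty ι›
  have hA : ∀ S : {S : E // 0 ≤ S}, ∃ i, i₀ ≤ i ∧ φ i S ≤ ε / 8 := fun S =>
    ((eventually_ge_atTop i₀).and ((tendsto_apply_of_isGLB hanti hglb S.2).eventually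
      (ge_mem_nhds (by positivity)))).exists
  choose A hA0 hA1 using hA
  -- `S n` is the sum of the first `n` vectors; the next one is chosen against `4 ^ n • S n`.
  let idx : ℕ → {S : E // 0 ≤ S} → ι := fun n S =>
    A ⟨(4 : ℝ) ^ n • S.1, smul_nonneg (by positivity) S.2⟩
  let S : ℕ → {S : E // 0 ≤ S} := fun n =>
    Nat.rec ⟨0, le_rfl⟩ (fun n S => ⟨S.1 + X (idx n S), add_nonneg S.2 (hX0 _)⟩) n
  let i : ℕ → ι := fun n => idx n (S n)
  let x : ℕ → E := fun n => X (i n)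
  have hS : ∀ n, (S n).1 = ∑ k ∈ Finset.range n, x k := by
    intro n
    induction n with
    | zero => rfl
    | succ n ih =>
      rw [Finset.sum_range_succ, ← ih]
  have hsum : Summable fun n => (1 / 2 : ℝ) ^ n • x n := by
    refine Summable.of_norm_bounded summable_geometric_two fun n => ?_
    rw [norm_smul, Real.norm_of_nonneg (by positivity)]
    exact mul_le_of_le_one_right (by positivity) (hX1 _)
  have hx0 : ∀ n, 0 ≤ x n := fun n => hX0 _
  let z := ∑' n, (1 / 2 : ℝ) ^ n • x n
  have hz : ∀ n, (1 / 2 : ℝ) ^ n • x n ≤ z := fun n =>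
    hsum.le_tsum n fun k _ => smul_nonneg (by positivity) (hx0 k)
  have hz0 : 0 ≤ z := (smul_nonneg (by positivity) (hx0 0)).trans (hz 0)
  let v : ℕ → E := fun n =>
    (x n - (4 : ℝ) ^ n • ∑ i ∈ Finset.range n, x i - (1 / 2 : ℝ) ^ n • z)⁺
  have hv : ∀ n, ‖v n‖ ≤ 1 := by
    intro n
    refine (norm_le_norm_of_abs_le_abs ?_).trans (hX1 (i n))
    rw [abs_of_nonneg (posPart_nonneg _), abs_of_nonneg (hX0 _)]
    refine sup_le ?_ (hX0 _)
    exact (sub_le_self _ (smul_nonneg (by positivity) hz0)).trans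
      (sub_le_self _ (smul_nonneg (by positivity) (Finset.sum_nonneg fun k _ => hx0 k)))
  have hlow : ∀ n, ε / 2 - ε / 8 - (1 / 2 : ℝ) ^ n * φ i₀ z ≤ φ i₀ (v n) := by
    intro n
    have h1 : ε / 2 ≤ φ (i n) (x n) := hX2 _
    have h2 : φ (i n) ((4 : ℝ) ^ n • ∑ i ∈ Finset.range n, x i) ≤ ε / 8 := by
      rw [← hS]
      exact hA1 ⟨(4 : ℝ) ^ n • (S n).1, _⟩
    have hi : i₀ ≤ i n := hA0 _
    have h3 : φ (i n) z ≤ φ i₀ z := hanti hi z hz0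
    have h4 : φ (i n) (v n) ≤ φ i₀ (v n) := hanti hi _ (posPart_nonneg _)
    have h5 := apply_mono_of_nonneg (hpos (i n)) (le_posPart
      (x n - (4 : ℝ) ^ n • ∑ i ∈ Finset.range n, x i - (1 / 2 : ℝ) ^ n • z))
    rw [map_sub, map_sub, map_smul _ ((1 / 2 : ℝ) ^ n), smul_eq_mul] at h5
    have h6 : (1 / 2 : ℝ) ^ n * φ (i n) z ≤ (1 / 2 : ℝ) ^ n * φ i₀ z :=
      mul_le_mul_of_nonneg_left h3 (by positivity)
    exact le_trans (by linarith) (h5.trans h4)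
  have hlim : Tendsto (fun n : ℕ => ε / 2 - ε / 8 - (1 / 2 : ℝ) ^ n * φ i₀ z) atTop
      (𝓝 (ε / 2 - ε / 8 - 0 * φ i₀ z)) :=
    tendsto_const_nhds.sub
      ((tendsto_pow_atTop_nhds_zero_of_lt_one (by norm_num) (by norm_num)).mul_const _)
  have := le_of_tendsto_of_tendsto' hlim
    (H (φ i₀) (hpos i₀) v hv (isDisjointSeq_posPart_sub hx0 hz)) hlow
  linarith

end OrderContinuity

theorem theorem2
    {E : Type*} [NormedAddCommGroup E] [NormedSpace ℝ E] [CompleteSpace E] [Lattice E]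
    [IsOrderedAddMonoid E] [IsOrderedModule ℝ E] [HasSolidNorm E] [Nontrivial E]
    {F : Type*} [NormedAddCommGroup F] [NormedSpace ℝ F] [CompleteSpace F] [Lattice F]
    [IsOrderedAddMonoid F] [IsOrderedModule ℝ F] [HasSolidNorm F] [Nontrivial F] :
    (∀ T : E →L[ℝ] F, (∀ x : E, 0 ≤ x → 0 ≤ T x) → T.IsSemiCompact → T.IsAlmostMWeaklyCompact) ↔
      IsOrderContinuousNorm (StrongDual ℝ E) := by
  constructor
  · intro H
    exact isOrderContinuousNorm_of_tendsto_apply fun φ hφ x hx hd =>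
      tendsto_apply_of_forall_isAlmostMWeaklyCompact H hφ hx hd
  · intro hoc T hT hsc
    exact hsc.isAlmostMWeaklyCompact hT fun φ hφ x hx hd =>
      hoc.tendsto_apply_of_disjoint hφ (fun n => abs_nonneg (x n))
        (fun n => by rw [norm_abs_eq_norm]; exact hx n) hd
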